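/- Let $G$ be a group generated by a finite set $S=S^{-1}$, let $d$ be the metric on $G$ of the Cayley graph $\Gamma(G,S)$ (vertices $x$ and $xs$ adjacent for $s\in S$, $xs\neq x$) and $|x|=d(x,e)$. Let $\delta\ge 1$ be such that $(G,d)$ is $\delta$-hyperbolic in the sense of Gromov, i.e. $(x|z)_w\ge\min\{(x|y)_w,(y|z)_w\}-\delta$ for all $w,x,y,z\in G$, where $(x|y)_w=\frac12\big(d(x,w)+d(y,w)-d(x,y)\big)$. Let $N\in\mathbb R$ and let $L\ge1$ be an integer. Fix an enumeration $s_1,\dots,s_Q$ of $S$. *Ancestors.* $x$ is a parent of $y$ if $d(x,y)=1$ and $|y|=|x|+1$. For $y\neq e$, the p-parent $y^{\uparrow}$ is the parent of $y$ of the form $ys_i$ with $i$ least possible. For $k\le|g|$ let $g^{\uparrow k}$ be the result of $k$ successive passages to the p-parent, and let $g^{\Uparrow k}=g^{\uparrow Lk}$ (for $Lk\le|g|$) and $g^{\Uparrow}=g^{\Uparrow 1}$. The p-grandchildren of $y$ are the $x$ with $|x|=|y|+L$ and $x^{\Uparrow}=y$. *Types.* The ball type $T^b_N(x)$ is the function $y\mapsto|xy|-|x|$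 on $\{y\in G:|y|\le N\}$. Let $T^Z(g)=T^b_N(g)$ if $|g|\ge L$, and let $T^Z$ take pairwise distinct values that are not ball types on the elements of length $<L$. For each value $\tau$ of $T^Z$ fix a representative $g_\tau\in G$ with $T^Z(g_\tau)=\tau$ and an enumeration of the (finitely many) p-grandchildren of $g_\tau$ by $1,2,\dots,m_\tau$. For $|g|\ge L$ let $n_g$ be the number given to $g_\tau\,(g^{\Uparrow})^{-1}g$ among the p-grandchildren of $g_\tau$, where $\tau=T^Z(g^{\Uparrow})$ (for all sufficiently large $N$ it is one of them); for $|g|<L$ let $n_g=0$. The $A$-type is $T^A(g)=(T^Z(g),n_g)$. *$B$-type.* Let $Tor$ be the set of torsion elements of $G$ of length at most $16\delta$ and let $R=\max\big(\{|g^n|:g\in Tor,\ n\in\mathbb Z\}\cup\{16\delta\}\big)$. The set of cousins of $g$ is $C_g=\{g'\in G:|g'|=|g|,\ d(g,g')\le R\}$. For distinct $g',g''\in C_g$ let $k_{g',g''}$ be the least $k\ge0$ such that $g'^{\Uparrow k}$ and $g''^{\Uparrow k}$ exist and have different $A$-types (such $k$ exists for all sufficiently large $N$). Let $k^{(g)}_1>\dots>k^{(g)}_{M_g}$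 be the elements of $\{k_{g',g''}: g',g''\in C_g,\ g'\ne g''\}\cup\{0\}$ in decreasing order. The $B$-type of $g$ is $$T^B(g)=\Big\{\big(g^{-1}g',\,W_{g,g'}\big)\ :\ g'\in C_g\Big\},\qquad W_{g,g'}=\Big(T^A\big(g'^{\Uparrow k^{(g)}_i}\big)\Big)_{i=1}^{M_g}.$$ **Proposition.** There is a constant $N_1$, depending only on $G$, $S$ and $\delta$, such that for every $N\ge N_1$, every integer $L\ge1$ and all choices (of the enumeration of $S$, of the representatives $g_\tau$ and of the enumerations of their p-grandchildren) in the above construction, the following holds: if $g,h\in G$ satisfy $|g|=|h|$, $d(g,h)\le16\delta$ and $T^B(g)=T^B(h)$, then $g=h$. -/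

import Mathlib

noncomputable section

namespace HypGroup

variable {G : Type*} [Group G]

/-- The distance `d(x, y)` in the Cayley graph `Γ(G, S)`. -/
def dist (S : Finset G) (x y : G) : ℕ :=
  (SimpleGraph.mulCayley (S : Set G)).dist x y

/-- The length `|x| = d(x, e)`. -/
def len (S : Finset G) (x : G) : ℕ := dist S x 1

/-- The Gromov product `(x | y)_w`. -/
def gromovProduct (S : Finset G) (w x y : G) : ℝ :=
  ((dist S x w : ℝ) + (dist S y w : ℝ) - (dist S x y : ℝ)) / 2

/-- `δ`-hyperbolicity in the sense of Gromov (four-point condition) of `G` with the metric of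
the Cayley graph `Γ(G, S)`. -/
def IsHyperbolicWith (S : Finset G) (δ : ℝ) : Prop :=
  ∀ w x y z : G,
    min (gromovProduct S w x y) (gromovProduct S w y z) - δ ≤ gromovProduct S w x z

/-! ### Ancestors and prioritised ancestors -/

/-- `y` is a descendant of `x`. -/
def IsDescendant (S : Finset G) (x y : G) : Prop := len S y = len S x + dist S x y

/-- `x` is a parent of `y`. -/
def IsParent (S : Finset G) (x y : G) : Prop := IsDescendant S x y ∧ dist S x y = 1

/-- `x` is the p-parent of `y` with respect to the enumeration `s` of `S`: it is a parent of `y`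
and `x = y sᵢ` with `i` least possible. -/
def IsPParent (S : Finset G) (s : Fin S.card ≃ S) (x y : G) : Prop :=
  ∃ i, x = y * (s i : G) ∧ IsParent S x y ∧ ∀ j < i, ¬ IsParent S (y * (s j : G)) y

open Classical in
/-- The p-parent `y↑` of `y` (and `1` if there is none, which happens only for `y = 1`). -/
def pParent (S : Finset G) (s : Fin S.card ≃ S) (y : G) : G :=
  if h : ∃ x, IsPParent S s x y then h.choose else 1

theorem IsPParent.unique {S : Finset G} {s : Fin S.card ≃ S} {x x' y : G}
    (h : IsPParent S s x y) (h' : IsPParent S s x' y) : x = x' := by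
  obtain ⟨i, rfl, hi, hmin⟩ := h
  obtain ⟨j, rfl, hj, hmin'⟩ := h'
  rcases lt_trichotomy i j with hij | rfl | hij
  · exact absurd hi (hmin' i hij)
  · rfl
  · exact absurd hj (hmin j hij)

theorem pParent_eq {S : Finset G} {s : Fin S.card ≃ S} {x y : G}
    (h : IsPParent S s x y) : pParent S s y = x := by
  have hex : ∃ x, IsPParent S s x y := ⟨x, h⟩
  rw [pParent, dif_pos hex]
  exact hex.choose_spec.unique h

/-- The p-ancestor `g^{↑k}` of `g`, meaningful for `k ≤ |g|`. -/
def pUp (S : Finset G) (s : Fin S.card ≃ S) (k : ℕ) (g : G) : G := (pParent S s)^[k] g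

/-- `x` is a p-ancestor of `y` (and `y` a p-descendant of `x`): the reflexive-transitive closure
of p-parenthood. -/
def IsPAncestor (S : Finset G) (s : Fin S.card ≃ S) (x y : G) : Prop :=
  Relation.ReflTransGen (IsPParent S s) x y

/-- The set of p-grandchildren of `y`: the p-descendants of length `|y| + L`. -/
def pGrandchildren (S : Finset G) (s : Fin S.card ≃ S) (L : ℕ) (y : G) : Set G :=
  {x | IsPAncestor S s y x ∧ len S x = len S y + L}

/-! ### The ball type and the `Z`-type -/

/-- The ball `N`-type of `x`: the function `y ↦ |xy| - |x|` on the ball `B_N(e)`. -/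
def ballType (S : Finset G) (N : ℝ) (x : G) : {y : G // (len S y : ℝ) ≤ N} → ℤ :=
  fun y => (len S (x * y) : ℤ) - (len S x : ℤ)

/-- Values of the `Z`-type: ball `N`-types, together with an extra value for each element
of `G` (used only for elements of length `< L`). -/
abbrev ZVal (S : Finset G) (N : ℝ) : Type _ := ({y : G // (len S y : ℝ) ≤ N} → ℤ) ⊕ G

open Classical in
/-- The `Z`-type: the ball `N`-type for elements of length `≥ L`, and pairwise distinct values
that are not ball types for elements of length `< L`. -/
def zType (S : Finset G) (N : ℝ) (L : ℕ) (g : G) : ZVal S N :=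
  if L ≤ len S g then Sum.inl (ballType S N g) else Sum.inr g

/-- The arbitrary choices made in the construction of the `A`- and `B`-types:
an enumeration of `S`, a representative `rep τ` of every `Z`-type `τ`, and an enumeration
(by `1, …, m`) of the p-grandchildren of every representative.
(The values of `rep` and `num` outside the set of `Z`-types are irrelevant.) -/
structure Choices (S : Finset G) (N : ℝ) (L : ℕ) where
  s : Fin S.card ≃ S
  rep : ZVal S N → G
  zType_rep : ∀ g : G, zType S N L (rep (zType S N L g)) = zType S N L g
  num : ZVal S N → G → ℕ
  num_bijOn : ∀ g : G,
    Set.BijOn (num (zType S N L g)) (pGrandchildren S s L (rep (zType S N L g)))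
      (Set.Icc 1 (pGrandchildren S s L (rep (zType S N L g))).ncard)

section Types

variable {S : Finset G} {N : ℝ} {L : ℕ} (c : Choices S N L)

/-- `g^{⇑k} = g^{↑Lk}`, meaningful for `L k ≤ |g|`. -/
def gUp (k : ℕ) (g : G) : G := pUp S c.s (L * k) g

/-- The element `γ_g` translating `g` to the representative of its `Z`-type. -/
def translator (g : G) : G := c.rep (zType S N L g) * g⁻¹

open Classical in
/-- The descendant number `n_g`. -/
def descNum (g : G) : ℕ :=
  if L ≤ len S g then c.num (zType S N L (gUp c 1 g)) (translator c (gUp c 1 g) * g) else 0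

/-- The `A`-type. -/
def aType (g : G) : ZVal S N × ℕ := (zType S N L g, descNum c g)

end Types

/-! ### Cousins and the `B`-type -/

/-- The set `Tor` of torsion elements of length at most `16δ`. -/
def Tor (S : Finset G) (δ : ℝ) : Set G := {g | (len S g : ℝ) ≤ 16 * δ ∧ IsOfFinOrder g}

/-- The constant `R`: the maximum of `16δ` and of the lengths of powers of elements of `Tor`
(finitely many numbers, so that the supremum is a maximum). -/
def cousinRadius (S : Finset G) (δ : ℝ) : ℝ :=
  sSup ({r : ℝ | ∃ g ∈ Tor S δ, ∃ n : ℤ, r = (len S (g ^ n) : ℝ)} ∪ {16 * δ})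

/-- The set `C_g` of cousins of `g`. -/
def cousins (S : Finset G) (δ : ℝ) (g : G) : Set G :=
  {g' | len S g = len S g' ∧ (dist S g g' : ℝ) ≤ cousinRadius S δ}

open Classical in
/-- The elements of a finite set of natural numbers, arranged in decreasing order. -/
def decreasingList (K : Set ℕ) : List ℕ :=
  if h : K.Finite then h.toFinset.sort (fun a b => b ≤ a) else []

section Types

variable {S : Finset G} {N : ℝ} {L : ℕ} (c : Choices S N L) (δ : ℝ)

/-- `k_{g',g''}`: the least `k` for which the p-ancestors `g'^{⇑k}`, `g''^{⇑k}` exist and have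
different `A`-types. -/
def diffGen (g' g'' : G) : ℕ :=
  sInf {k | L * k ≤ len S g' ∧ L * k ≤ len S g'' ∧ aType c (gUp c k g') ≠ aType c (gUp c k g'')}

/-- The sequence `k^{(g)}`: the set `{k_{g',g''} | g' ≠ g'' cousins of g} ∪ {0}`, which is finite,
in decreasing order. -/
def kSeq (g : G) : List ℕ :=
  decreasingList
    ({k | ∃ g' ∈ cousins S δ g, ∃ g'' ∈ cousins S δ g, g' ≠ g'' ∧ k = diffGen c g' g''} ∪ {0})

/-- The sequence `W_{g,g'}` of the `A`-types of `g'^{⇑k}`, with `k` running through `k^{(g)}`. -/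
def wSeq (g g' : G) : List (ZVal S N × ℕ) :=
  (kSeq c δ g).map (fun k => aType c (gUp c k g'))

/-- The `B`-type of `g`. -/
def bType (g : G) : Set (G × List (ZVal S N × ℕ)) :=
  {p | ∃ g' ∈ cousins S δ g, p = (g⁻¹ * g', wSeq c δ g g')}

end Types

end HypGroup

end

namespace HypGroup

/-! ### Word metric: left invariance, geodesics, finite balls, four-point inequality -/

section Metric

variable {G : Type*} [Group G] {S : Finset G}

/-! Write `h = g * γ`. The idea is that equal types force `γ` to be torsion, and that the `B`-type
sees enough of the orbit of `g` under a torsion element to exclude `γ ≠ 1`.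

Equal `B`-types give equal `A`-types, hence equal `Z`-types. For short elements this already says `g
= h`. Otherwise the ball types agree, and evaluating them at powers of `γ` shows that `g * γ ^ i`
stays on the sphere of `g` for all `|i| ≤ n`, once `N ≥ 16δn`. A long piece of an orbit on a sphere
has an approximate centre `p`, which many of the isometries `g * γ ^ i * g⁻¹` move by at most `8δ +
1`. If `n` exceeds a bound given by the size of that ball, two of them coincide, so `γ` is torsion
(`isOfFinOrder_of_len_mul_zpow_eq`).

For torsion `γ`, the radius `R` makes the whole orbit consist of cousins of both `g` and `g * γ`,
and equality of `B`-types identifies the sequence `W` of `g * γ ^ n` at `g` with that of `g * γ ^ (n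
+ 1)` at `g * γ`. At the least generation `k` where two orbit points differ in `A`-type, this makes
the `A`-type constant along the orbit, a contradiction (`eq_of_bType_eq_of_mem_Tor`). Such a `k`
exists because the `A`-types of all the ancestors determine an element of given length
(`exists_aType_gUp_ne`), which rests on the ball type determining the cone. -/

theorem connected_mulCayley (hgen : Subgroup.closure (S : Set G) = ⊤) :
    (SimpleGraph.mulCayley (S : Set G)).Connected := by
  have step : ∀ x : G, ∀ s ∈ (S : Set G),
      (SimpleGraph.mulCayley (S : Set G)).Reachable x (x * s) := by
    intro x s hs
    by_cases h : x = x * s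
    · rw [← h]
    · exact SimpleGraph.Adj.reachable ((SimpleGraph.mulCayley_adj _ _ _).2 ⟨h, Or.inl (by simpa)⟩)
  have key : ∀ y : G, ∀ x : G, (SimpleGraph.mulCayley (S : Set G)).Reachable x (x * y) := by
    intro y
    have hy : y ∈ Subgroup.closure (S : Set G) := by rw [hgen]; trivial
    induction hy using Subgroup.closure_induction with
    | mem s hs => exact fun x => step x s hs
    | one => intro x; rw [mul_one]
    | mul a b _ _ ha hb => intro x; rw [← mul_assoc]; exact (ha x).trans (hb _)
    | inv a _ ha => intro x; simpa using (ha (x * a⁻¹)).symm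
  have : Nonempty G := ⟨1⟩
  refine SimpleGraph.Connected.mk fun x y => ?_
  simpa using key (x⁻¹ * y) x

theorem dist_self (x : G) : dist S x x = 0 := SimpleGraph.dist_self

theorem dist_comm (x y : G) : dist S x y = dist S y x := SimpleGraph.dist_comm

theorem dist_triangle (hgen : Subgroup.closure (S : Set G) = ⊤) (x y z : G) :
    dist S x z ≤ dist S x y + dist S y z :=
  (connected_mulCayley hgen).dist_triangle

theorem dist_eq_zero (hgen : Subgroup.closure (S : Set G) = ⊤) {x y : G} :
    dist S x y = 0 ↔ x = y :=
  (connected_mulCayley hgen).dist_eq_zero_iff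

theorem dist_mul_left (hgen : Subgroup.closure (S : Set G) = ⊤) (a x y : G) :
    dist S (a * x) (a * y) = dist S x y := by
  have key : ∀ a x y : G, dist S (a * x) (a * y) ≤ dist S x y := by
    intro a x y
    obtain ⟨p, hp⟩ := (connected_mulCayley hgen).exists_walk_length_eq_dist x y
    let f : SimpleGraph.mulCayley (S : Set G) →g SimpleGraph.mulCayley (S : Set G) :=
      ⟨fun x => a * x, fun h => SimpleGraph.mulCayley_adj_mul_iff_right.2 h⟩
    have := SimpleGraph.dist_le (p.map f)
    rw [SimpleGraph.Walk.length_map, hp] at this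
    exact this
  refine le_antisymm (key a x y) ?_
  simpa using key a⁻¹ (a * x) (a * y)

theorem dist_mul_right_self (hgen : Subgroup.closure (S : Set G) = ⊤) (a x : G) :
    dist S a (a * x) = len S x := by
  have := dist_mul_left hgen a 1 x
  rw [mul_one] at this
  rw [this, dist_comm, len]

theorem dist_eq_len (hgen : Subgroup.closure (S : Set G) = ⊤) (x y : G) :
    dist S x y = len S (x⁻¹ * y) := by
  rw [← dist_mul_right_self hgen x, mul_inv_cancel_left]

theorem len_one : len S (1 : G) = 0 := dist_self 1

theorem len_eq_zero (hgen : Subgroup.closure (S : Set G) = ⊤) {x : G} : len S x = 0 ↔ x = 1 :=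
  dist_eq_zero hgen

theorem len_inv (hgen : Subgroup.closure (S : Set G) = ⊤) (x : G) : len S x⁻¹ = len S x := by
  have := dist_eq_len hgen x 1
  rw [mul_one] at this
  exact this.symm

theorem len_mul_le (hgen : Subgroup.closure (S : Set G) = ⊤) (x y : G) :
    len S (x * y) ≤ len S x + len S y := by
  rw [len, dist_comm _ 1]
  have h2 := dist_triangle hgen 1 x (x * y)
  rw [dist_mul_right_self hgen, dist_comm 1 x] at h2
  exact h2

theorem len_pow_le (hgen : Subgroup.closure (S : Set G) = ⊤) (x : G) (n : ℕ) :
    len S (x ^ n) ≤ n * len S x := by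
  induction n with
  | zero => simp [len_one]
  | succ n ih =>
    rw [pow_succ]
    have := len_mul_le hgen (x ^ n) x
    linarith

theorem len_zpow_le (hgen : Subgroup.closure (S : Set G) = ⊤) (x : G) (n : ℤ) :
    len S (x ^ n) ≤ n.natAbs * len S x := by
  rcases Int.natAbs_eq n with h | h
  · conv_lhs => rw [h]
    rw [zpow_natCast]
    exact len_pow_le hgen x _
  · conv_lhs => rw [h]
    rw [zpow_neg, zpow_natCast, len_inv hgen]
    exact len_pow_le hgen x _

theorem exists_dist_eq_of_le (hgen : Subgroup.closure (S : Set G) = ⊤) (x y : G) {t : ℕ}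
    (ht : t ≤ dist S x y) : ∃ p, dist S x p = t ∧ dist S p y + t = dist S x y := by
  obtain ⟨w, hw⟩ := (connected_mulCayley hgen).exists_walk_length_eq_dist x y
  have h1 := SimpleGraph.dist_le (w.take t)
  have h2 := SimpleGraph.dist_le (w.drop t)
  rw [SimpleGraph.Walk.take_length] at h1
  rw [SimpleGraph.Walk.drop_length] at h2
  have h3 := dist_triangle hgen x (w.getVert t) y
  change dist S _ _ ≤ _ at h1
  change dist S _ _ ≤ _ at h2
  change w.length = dist S _ _ at hw
  refine ⟨w.getVert t, ?_, ?_⟩ <;> omega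

theorem exists_mem_of_dist_eq_one (hinv : ∀ x ∈ S, x⁻¹ ∈ S) {x y : G} (h : dist S x y = 1) :
    ∃ s ∈ S, y = x * s := by
  have := (SimpleGraph.mulCayley_adj _ _ _).1 (SimpleGraph.dist_eq_one_iff_adj.1 h)
  rcases this.2 with h | h
  · exact ⟨_, h, by simp⟩
  · exact ⟨_, hinv _ h, by simp⟩

theorem len_le_one_of_mem {s : G} (hs : s ∈ S) : len S s ≤ 1 := by
  by_cases h : s = 1
  · rw [h, len_one]; exact zero_le_one
  · refine (SimpleGraph.dist_eq_one_iff_adj.2 ?_).le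
    exact (SimpleGraph.mulCayley_adj _ _ _).2 ⟨h, Or.inr (by simpa)⟩

theorem finite_setOf_len_le (hgen : Subgroup.closure (S : Set G) = ⊤) (hinv : ∀ x ∈ S, x⁻¹ ∈ S)
    (n : ℕ) : {x : G | len S x ≤ n}.Finite := by
  induction n with
  | zero =>
    refine (Set.finite_singleton (1 : G)).subset fun x hx => ?_
    exact (len_eq_zero hgen).1 (Nat.le_zero.1 hx)
  | succ n ih =>
    refine (ih.union (ih.mul S.finite_toSet)).subset fun x hx => ?_
    rcases Nat.lt_or_ge n (len S x) with h | h
    · right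
      have hx' : len S x ≤ n + 1 := hx
      obtain ⟨p, hp1, hp2⟩ := exists_dist_eq_of_le hgen x 1 (t := 1) (by change 1 ≤ len S x; omega)
      rw [dist_comm] at hp1
      obtain ⟨s, hs, rfl⟩ := exists_mem_of_dist_eq_one hinv hp1
      refine Set.mul_mem_mul ?_ hs
      change len S p + 1 = len S _ at hp2
      change len S p ≤ n
      omega
    · exact Or.inl h

theorem finite_setOf_len_le_real (hgen : Subgroup.closure (S : Set G) = ⊤)
    (hinv : ∀ x ∈ S, x⁻¹ ∈ S) (r : ℝ) : {x : G | (len S x : ℝ) ≤ r}.Finite :=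
  (finite_setOf_len_le hgen hinv ⌊r⌋₊).subset fun _ hx => Nat.le_floor hx

/-- The four-point condition in terms of sums of opposite distances. -/
theorem IsHyperbolicWith.four_point {δ : ℝ} (hyp : IsHyperbolicWith S δ) (w x y z : G) :
    (dist S x z + dist S y w : ℝ) ≤
      max (dist S x y + dist S z w : ℝ) (dist S y z + dist S x w : ℝ) + 2 * δ := by
  have := hyp w x y z
  simp only [gromovProduct] at this
  rcases min_choice (((dist S x w : ℝ) + dist S y w - dist S x y) / 2)
      (((dist S y w : ℝ) + dist S z w - dist S y z) / 2) with h | h <;> rw [h] at this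
  · have := le_max_left (dist S x y + dist S z w : ℝ) (dist S y z + dist S x w : ℝ)
    linarith
  · have := le_max_right (dist S x y + dist S z w : ℝ) (dist S y z + dist S x w : ℝ)
    linarith

end Metric

/-! ### Long orbits on a sphere force torsion -/

section Torsion

variable {G : Type*} [Group G] {S : Finset G}

/-- An element whose powers move `g` along the sphere around `1` for sufficiently long
is a torsion element. -/
theorem isOfFinOrder_of_len_mul_zpow_eq (hgen : Subgroup.closure (S : Set G) = ⊤)
    (hinv : ∀ x ∈ S, x⁻¹ ∈ S) {δ : ℝ} (hyp : IsHyperbolicWith S δ) {n : ℕ}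
    (hn : 2 * {x : G | (len S x : ℝ) ≤ 8 * δ + 1}.ncard < n + 1) {g γ : G}
    (hsphere : ∀ i : ℤ, i.natAbs ≤ n → len S (g * γ ^ i) = len S g) : IsOfFinOrder γ := by
  classical
  have hdist : ∀ i j : ℤ, dist S (g * γ ^ i) (g * γ ^ j) = len S (γ ^ (j - i)) := by
    intro i j
    rw [dist_mul_left hgen, dist_eq_len hgen, sub_eq_neg_add, zpow_add, zpow_neg]
  have hdist0 : ∀ j : ℤ, dist S g (g * γ ^ j) = len S (γ ^ j) := fun j =>
    dist_mul_right_self hgen _ _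
  have hneg : ∀ i : ℤ, len S (γ ^ (-i)) = len S (γ ^ i) := by
    intro i; rw [zpow_neg, len_inv hgen]
  obtain ⟨m, hmn, hmax⟩ := Finset.exists_max_image (Finset.range (n + 1))
    (fun i : ℕ => len S (γ ^ (i : ℤ))) ⟨0, by simp⟩
  rw [Finset.mem_range] at hmn
  have hmax' : ∀ i : ℤ, i.natAbs ≤ n → len S (γ ^ i) ≤ len S (γ ^ (m : ℤ)) := by
    intro i hi
    have := hmax i.natAbs (by simp; omega)
    rcases Int.natAbs_eq i with h | h
    · rw [h]; exact this
    · rw [h, hneg]; exact this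
  -- `t` is half the largest displacement, rounded up. The point `p` at distance `t` from `g`
  -- towards `1` is an approximate centre of the orbit piece.
  obtain ⟨t, ht1, ht2⟩ : ∃ t, len S (γ ^ (m : ℤ)) ≤ 2 * t ∧ 2 * t ≤ len S (γ ^ (m : ℤ)) + 1 :=
    ⟨(len S (γ ^ (m : ℤ)) + 1) / 2, by omega, by omega⟩
  have htD : t ≤ len S g := by
    have h1 := dist_triangle hgen g 1 (g * γ ^ (m : ℤ))
    rw [hdist0, dist_comm 1] at h1
    change _ ≤ len S g + len S (g * γ ^ (m : ℤ)) at h1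
    rw [hsphere m (by simp; omega)] at h1
    omega
  obtain ⟨p, hp1, hp2⟩ := exists_dist_eq_of_le hgen g 1 htD
  have hpa : ∀ i : ℤ, i.natAbs ≤ n → (dist S p (g * γ ^ i) : ℝ) ≤ t + 2 * δ := by
    intro i hi
    have h4 := hyp.four_point 1 p g (g * γ ^ i)
    rw [dist_comm p g, hp1, hdist0] at h4
    have e1 : dist S (g * γ ^ i) 1 = dist S g 1 := hsphere i hi
    have e2 : (dist S p 1 : ℝ) + t = dist S g 1 := mod_cast hp2
    have e3 : (len S (γ ^ i) : ℝ) ≤ 2 * t := mod_cast (hmax' i hi).trans ht1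
    rw [e1] at h4
    have : max ((t : ℝ) + dist S g 1) (len S (γ ^ i) + dist S p 1) ≤ t + dist S g 1 :=
      max_le le_rfl (by linarith)
    linarith
  -- The isometry `g * γ ^ i * g⁻¹` takes `g` to `g * γ ^ i` and `g * γ ^ (-i)` to `g`. If `γ ^ i`
  -- has nearly maximal length, both `p` and its image are near the midpoint between `g` and `g * γ
  -- ^ i`.
  have hq : ∀ i : ℤ, i.natAbs ≤ n → (len S (γ ^ (m : ℤ)) : ℝ) ≤ len S (γ ^ i) + 2 * δ →
      (len S (p⁻¹ * (g * γ ^ i * g⁻¹ * p)) : ℝ) ≤ 8 * δ + 1 := by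
    intro i hi hbig
    rw [← dist_eq_len hgen]
    have h4 := hyp.four_point (g * γ ^ i) p g (g * γ ^ i * g⁻¹ * p)
    have e1 : dist S (g * γ ^ i * g⁻¹ * p) (g * γ ^ i) = t := by
      have := dist_mul_left hgen (g * γ ^ i * g⁻¹) p g
      rwa [inv_mul_cancel_right, dist_comm p g, hp1] at this
    have e2 : dist S g (g * γ ^ i * g⁻¹ * p) = dist S p (g * γ ^ (-i)) := by
      have := dist_mul_left hgen (g * γ ^ i * g⁻¹) (g * γ ^ (-i)) p
      rw [dist_comm _ p] at this
      rw [← this]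
      congr 1
      group
    rw [hdist0, e1, e2, dist_comm p g, hp1] at h4
    have e3 := hpa i hi
    have e4 := hpa (-i) (by omega)
    have e5 : (2 * t : ℝ) ≤ len S (γ ^ (m : ℤ)) + 1 := mod_cast ht2
    have hδ : 0 ≤ δ := by
      have := hyp 1 1 1 1
      simp [gromovProduct, dist_self] at this
      exact this
    have : max ((t : ℝ) + t) (dist S p (g * γ ^ (-i)) + dist S p (g * γ ^ i)) ≤
        2 * t + 4 * δ := max_le (by linarith) (by linarith)
    linarith
  -- Since `g`, `g * γ ^ i` and `g * γ ^ m` are equidistant from `1`, the four-point inequality is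
  -- ultrametric up to `2δ` on them.
  have hor : ∀ i : ℕ, i < n + 1 →
      (len S (γ ^ (m : ℤ)) : ℝ) ≤ len S (γ ^ (i : ℤ)) + 2 * δ ∨
      (len S (γ ^ (m : ℤ)) : ℝ) ≤ len S (γ ^ ((m : ℤ) - i)) + 2 * δ := by
    intro i hi
    have h4 := hyp.four_point 1 g (g * γ ^ (i : ℤ)) (g * γ ^ (m : ℤ))
    rw [hdist0, hdist0, hdist] at h4
    have e1 : dist S (g * γ ^ (i : ℤ)) 1 = dist S g 1 := hsphere i (by simp; omega)
    have e2 : dist S (g * γ ^ (m : ℤ)) 1 = dist S g 1 := hsphere m (by simp; omega)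
    rw [e1, e2] at h4
    rcases max_choice ((len S (γ ^ (i : ℤ)) : ℝ) + dist S g 1)
      (len S (γ ^ ((m : ℤ) - i)) + dist S g 1) with h | h <;> rw [h] at h4
    · left; linarith
    · right; linarith
  by_contra hfin
  have hinj := injective_zpow_iff_not_isOfFinOrder.2 hfin
  have hBfin := finite_setOf_len_le_real hgen hinv (8 * δ + 1)
  let q : ℤ → G := fun i => p⁻¹ * (g * γ ^ i * g⁻¹ * p)
  have hqinj : Function.Injective q := by
    intro i j hij
    apply hinj
    simpa [q] using hij
  -- The Boolean records which of `i` and `m - i` was used, so that `f` is injective when `γ` has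
  -- infinite order; this costs the factor 2 in `hn`.
  let f : ℕ → G × Bool := fun i =>
    if (len S (γ ^ (m : ℤ)) : ℝ) ≤ len S (γ ^ (i : ℤ)) + 2 * δ then (q i, true)
    else (q ((m : ℤ) - i), false)
  have hf : ∀ i ∈ Finset.range (n + 1), f i ∈ hBfin.toFinset ×ˢ (Finset.univ : Finset Bool) := by
    intro i hi
    rw [Finset.mem_range] at hi
    simp only [Finset.mem_product, Set.Finite.mem_toFinset, Finset.mem_univ, and_true,
      Set.mem_ofPred_eq, f]
    split_ifs with h
    · exact hq i (by simp; omega) h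
    · exact hq _ (by omega) ((hor i hi).resolve_left h)
  have hcard : (hBfin.toFinset ×ˢ (Finset.univ : Finset Bool)).card <
      (Finset.range (n + 1)).card := by
    rw [Finset.card_product, ← Set.ncard_eq_toFinset_card _ hBfin]
    simp only [Finset.card_univ, Fintype.card_bool, Finset.card_range]
    omega
  obtain ⟨i, _, j, _, hij, he⟩ := Finset.exists_ne_map_eq_of_card_lt_of_maps_to hcard hf
  simp only [f] at he
  split_ifs at he with h1 h2 h2
  · have := hqinj (Prod.ext_iff.1 he).1
    omega
  · simp at he
  · simp at he
  · have := hqinj (Prod.ext_iff.1 he).1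
    omega

end Torsion

/-! ### The ball type determines the cone -/

section Cones

variable {G : Type*} [Group G] {S : Finset G} {N δ : ℝ}

theorem len_mul_sub_of_ballType_eq {g g' : G} (h : ballType S N g = ballType S N g') {y : G}
    (hy : (len S y : ℝ) ≤ N) : (len S (g * y) : ℤ) - len S g = len S (g' * y) - len S g' :=
  congrFun h ⟨y, hy⟩

/-- The ball type of `g` bounds the lengths of the neighbours of the elements of the cone
of `g`. -/
theorem len_mul_mul_le_of_ballType_eq (hgen : Subgroup.closure (S : Set G) = ⊤) (hδ : 0 ≤ δ)
    (hyp : IsHyperbolicWith S δ) (hN : 2 * δ + 2 ≤ N) {g g' : G}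
    (hb : ballType S N g = ballType S N g') {z w : G} (hz : len S (g * z) = len S g + len S z)
    (hw : len S w ≤ 1) :
    len S (g' * z * w) + len S g ≤ len S (g * z * w) + len S g' := by
  have hzw : dist S g (g * z * w) ≤ len S z + 1 := by
    rw [mul_assoc, dist_mul_right_self hgen]
    exact (len_mul_le hgen z w).trans (by omega)
  have hv : len S g + len S z ≤ len S (g * z * w) + 1 := by
    have := len_mul_le hgen (g * z * w) w⁻¹
    rw [mul_inv_cancel_right, len_inv hgen, hz] at this
    omega
  have hlen : ∀ x : G, dist S 1 x = len S x := fun x => dist_comm 1 x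
  -- A geodesic from `1` to `g * z * w` passes within `2δ + 2` of `g`, at `u`. The ball type knows
  -- the length change at `g⁻¹ * u`, and the remaining segment can be translated.
  obtain ⟨u, hu1, hu2⟩ := exists_dist_eq_of_le hgen 1 (g * z * w)
    (t := min (len S g) (len S (g * z * w))) (by rw [hlen]; exact min_le_right _ _)
  rw [hlen] at hu1 hu2
  have hgu : (dist S g u : ℝ) ≤ 2 * δ + 2 := by
    rcases le_or_gt (len S g) (len S (g * z * w)) with hc | hc
    · rw [min_eq_left hc] at hu1 hu2
      have h4 := hyp.four_point (g * z * w) g 1 u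
      rw [hlen, hlen, hu1] at h4
      change _ ≤ max ((len S g : ℝ) + _) _ + _ at h4
      have e1 : (dist S u (g * z * w) : ℝ) + len S g = len S (g * z * w) := mod_cast hu2
      have e2 : (dist S g (g * z * w) : ℝ) ≤ len S z + 1 := mod_cast hzw
      have e3 : (len S g : ℝ) + len S z ≤ len S (g * z * w) + 1 := mod_cast hv
      have : max ((len S g : ℝ) + dist S u (g * z * w)) (len S g + dist S g (g * z * w)) ≤
          len S (g * z * w) + 2 := max_le (by linarith) (by linarith)
      linarith
    · rw [min_eq_right hc.le] at hu2
      have : u = g * z * w := (dist_eq_zero hgen).1 (by omega)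
      rw [this]
      have e : dist S g (g * z * w) ≤ 1 := by omega
      have e' : (dist S g (g * z * w) : ℝ) ≤ 1 := mod_cast e
      linarith
  have hb' := len_mul_sub_of_ballType_eq hb (y := g⁻¹ * u) (by
    rw [← dist_eq_len hgen]; linarith)
  rw [mul_inv_cancel_left] at hb'
  have hle := len_mul_le hgen (g' * (g⁻¹ * u)) (u⁻¹ * (g * z * w))
  rw [← dist_eq_len hgen] at hle
  have : g' * (g⁻¹ * u) * (u⁻¹ * (g * z * w)) = g' * z * w := by group
  rw [this] at hle
  omega

theorem len_mul_mul_eq_of_ballType_eq (hgen : Subgroup.closure (S : Set G) = ⊤) (hδ : 0 ≤ δ)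
    (hyp : IsHyperbolicWith S δ) (hN : 2 * δ + 2 ≤ N) {g g' : G}
    (hb : ballType S N g = ballType S N g') {z w : G} (hz : len S (g * z) = len S g + len S z)
    (hz' : len S (g' * z) = len S g' + len S z) (hw : len S w ≤ 1) :
    len S (g' * z * w) + len S g = len S (g * z * w) + len S g' :=
  le_antisymm (len_mul_mul_le_of_ballType_eq hgen hδ hyp hN hb hz hw)
    (len_mul_mul_le_of_ballType_eq hgen hδ hyp hN hb.symm hz' hw)

end Cones

/-! ### Ancestors and the separating power of `A`-types -/

section Descendants

variable {G : Type*} [Group G] {S : Finset G} {N δ : ℝ}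

/-- Left translation between two elements of the same ball type preserves p-descendants. -/
theorem IsPAncestor.translate (hgen : Subgroup.closure (S : Set G) = ⊤) (hδ : 0 ≤ δ)
    (hinv : ∀ x ∈ S, x⁻¹ ∈ S) (hyp : IsHyperbolicWith S δ) (hN : 2 * δ + 2 ≤ N)
    {s : Fin S.card ≃ S} {g g' : G} (hb : ballType S N g = ballType S N g') {x : G}
    (h : IsPAncestor S s g x) :
    len S x = len S g + len S (g⁻¹ * x) ∧ len S (g' * (g⁻¹ * x)) = len S g' + len S (g⁻¹ * x) ∧
      IsPAncestor S s g' (g' * (g⁻¹ * x)) := by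
  induction h with
  | refl =>
    rw [inv_mul_cancel, len_one, mul_one]
    exact ⟨rfl, rfl, Relation.ReflTransGen.refl⟩
  | @tail b x _ hp ih =>
    obtain ⟨ih1, ih2, ih3⟩ := ih
    obtain ⟨i, hbx, hpar, hmin⟩ := hp
    have hx : len S x = len S b + 1 := by
      have := hpar.1
      rw [IsDescendant, hpar.2] at this
      exact this
    have hxb : x = b * (s i : G)⁻¹ := by rw [hbx, mul_inv_cancel_right]
    have hw : len S (s i : G)⁻¹ ≤ 1 := len_le_one_of_mem (hinv _ (s i).2)
    have hz : len S (g⁻¹ * x) ≤ len S (g⁻¹ * b) + 1 := by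
      rw [hxb, ← mul_assoc]
      exact (len_mul_le hgen _ _).trans (by omega)
    have hz' : len S x ≤ len S g + len S (g⁻¹ * x) := by
      simpa using len_mul_le hgen g (g⁻¹ * x)
    have h1 : len S x = len S g + len S (g⁻¹ * x) := by omega
    have h2 : len S (g' * (g⁻¹ * x)) = len S g' + len S (g⁻¹ * x) := by
      have := len_mul_mul_eq_of_ballType_eq hgen hδ hyp hN hb (z := g⁻¹ * b)
        (by rw [mul_inv_cancel_left]; exact ih1) ih2 hw
      rw [mul_inv_cancel_left, ← hxb, mul_assoc, mul_assoc, ← hxb] at this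
      omega
    refine ⟨h1, h2, ih3.tail ?_⟩
    -- Parenthood depends only on the length change under `s j`, which is the same at `x` and at its
    -- translate, so the least index of a parent is also the same.
    have hiff : ∀ j, IsParent S (x * (s j : G)) x ↔
        IsParent S (g' * (g⁻¹ * x) * (s j : G)) (g' * (g⁻¹ * x)) := by
      intro j
      have hl := len_mul_mul_eq_of_ballType_eq hgen hδ hyp hN hb (z := g⁻¹ * x)
        (by rw [mul_inv_cancel_left]; exact h1) h2 (len_le_one_of_mem (s j).2)
      rw [mul_inv_cancel_left] at hl
      have hd : ∀ y : G, dist S (y * (s j : G)) y = len S (s j : G) := fun y => by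
        rw [dist_comm, dist_mul_right_self hgen]
      rw [IsParent, IsParent, IsDescendant, IsDescendant, hd, hd]
      constructor <;> rintro ⟨h3, h4⟩ <;> refine ⟨?_, h4⟩ <;> omega
    refine ⟨i, ?_, ?_, fun j hj => ?_⟩
    · rw [hbx]; simp only [mul_assoc]
    · have := (hiff i).1 (hbx ▸ hpar)
      have e : g' * (g⁻¹ * x) * (s i : G) = g' * (g⁻¹ * b) := by
        rw [hbx]; simp only [mul_assoc]
      rwa [e] at this
    · exact fun hc => hmin j hj ((hiff j).2 hc)

theorem isPParent_pParent (hgen : Subgroup.closure (S : Set G) = ⊤) (hinv : ∀ x ∈ S, x⁻¹ ∈ S)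
    (s : Fin S.card ≃ S) {y : G} (hy : 1 ≤ len S y) : IsPParent S s (pParent S s y) y := by
  suffices h : ∃ x, IsPParent S s x y by
    obtain ⟨x, hx⟩ := h
    rw [pParent_eq hx]
    exact hx
  obtain ⟨p, hp1, hp2⟩ := exists_dist_eq_of_le hgen y 1 hy
  obtain ⟨a, ha, rfl⟩ := exists_mem_of_dist_eq_one hinv hp1
  have hne : {i | IsParent S (y * (s i : G)) y}.Nonempty := by
    refine ⟨s.symm ⟨a, ha⟩, ?_⟩
    change IsParent S _ y
    rw [Equiv.apply_symm_apply, IsParent, IsDescendant, dist_comm _ y]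
    refine ⟨?_, hp1⟩
    rw [hp1]
    exact hp2.symm
  obtain ⟨i, hi, hmin⟩ := wellFounded_lt.has_min _ hne
  exact ⟨_, i, rfl, hi, fun j hj hc => hmin j hc hj⟩

theorem pUp_spec (hgen : Subgroup.closure (S : Set G) = ⊤) (hinv : ∀ x ∈ S, x⁻¹ ∈ S)
    (s : Fin S.card ≃ S) {g : G} {k : ℕ} (hk : k ≤ len S g) :
    IsPAncestor S s (pUp S s k g) g ∧ len S (pUp S s k g) + k = len S g := by
  induction k with
  | zero => exact ⟨Relation.ReflTransGen.refl, rfl⟩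
  | succ k ih =>
    obtain ⟨ih1, ih2⟩ := ih (by omega)
    have hp := isPParent_pParent hgen hinv s (y := pUp S s k g) (by omega)
    have e : pUp S s (k + 1) g = pParent S s (pUp S s k g) := Function.iterate_succ_apply' _ _ _
    rw [e]
    refine ⟨Relation.ReflTransGen.head hp ih1, ?_⟩
    obtain ⟨i, _, hpar, _⟩ := hp
    have := hpar.1
    rw [IsDescendant, hpar.2] at this
    omega

variable {L : ℕ}

theorem gUp_succ (c : Choices S N L) (k : ℕ) (g : G) : gUp c (k + 1) g = gUp c 1 (gUp c k g) := by
  rw [gUp, gUp, gUp, pUp, pUp, pUp, ← Function.iterate_add_apply, mul_add, add_comm]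

/-- This puts the argument of `num` in `descNum` inside the set on which `num` is injective, so that
an element is recovered from its ancestor and its descendant number. -/
theorem translator_mul_mem (hgen : Subgroup.closure (S : Set G) = ⊤) (hδ : 0 ≤ δ)
    (hinv : ∀ x ∈ S, x⁻¹ ∈ S) (hyp : IsHyperbolicWith S δ) (hN : 2 * δ + 2 ≤ N)
    (c : Choices S N L) {a x : G} (hx : x ∈ pGrandchildren S c.s L a) :
    translator c a * x ∈ pGrandchildren S c.s L (c.rep (zType S N L a)) := by
  have hrep := c.zType_rep a
  rw [translator]
  generalize c.rep (zType S N L a) = r at hrep ⊢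
  by_cases hL : L ≤ len S a
  · by_cases hL' : L ≤ len S r
    · rw [zType, zType, if_pos hL, if_pos hL'] at hrep
      obtain ⟨h1, h2, h3⟩ := hx.1.translate hgen hδ hinv hyp hN (Sum.inl_injective hrep).symm
      have h4 := hx.2
      rw [mul_assoc]
      exact ⟨h3, by omega⟩
    · rw [zType, zType, if_pos hL, if_neg hL'] at hrep
      cases hrep
  · by_cases hL' : L ≤ len S r
    · rw [zType, zType, if_neg hL, if_pos hL'] at hrep
      cases hrep
    · rw [zType, zType, if_neg hL, if_neg hL'] at hrep
      rw [Sum.inr_injective hrep, mul_inv_cancel, one_mul]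
      exact hx

/-- Distinct elements of the same length have ancestors of different `A`-types. -/
theorem exists_aType_gUp_ne (hgen : Subgroup.closure (S : Set G) = ⊤) (hδ : 0 ≤ δ)
    (hinv : ∀ x ∈ S, x⁻¹ ∈ S) (hyp : IsHyperbolicWith S δ) (hN : 2 * δ + 2 ≤ N) (hL : 1 ≤ L)
    (c : Choices S N L) {x y : G} (hlen : len S x = len S y) (hne : x ≠ y) :
    ∃ k, L * k ≤ len S x ∧ L * k ≤ len S y ∧ aType c (gUp c k x) ≠ aType c (gUp c k y) := by
  by_contra! hall
  have hspec : ∀ k, ∀ {g : G}, L * k ≤ len S g → IsPAncestor S c.s (gUp c k g) g ∧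
    len S (gUp c k g) + L * k = len S g := fun k g hk => pUp_spec hgen hinv c.s hk
  have key : ∀ j ≤ len S x / L, gUp c (len S x / L - j) x = gUp c (len S x / L - j) y := by
    intro j
    induction j with
    | zero =>
      intro _
      rw [Nat.sub_zero]
      -- The oldest ancestors have length `< L`, where the `Z`-type is injective. From there the
      -- descendant numbers give equality one generation down at a time.
      have hk : L * (len S x / L) ≤ len S x := Nat.mul_div_le _ _
      have hlt : len S x < L * (len S x / L) + L := Nat.lt_mul_div_succ _ hL
      have h1 := (hspec _ hk).2
      have h2 := (hspec _ (hk.trans hlen.le)).2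
      have := congrArg Prod.fst (hall _ hk (hlen ▸ hk))
      simp only [aType, zType] at this
      rw [if_neg (by omega), if_neg (by omega)] at this
      exact Sum.inr_injective this
    | succ j ih =>
      intro hj
      have ih := ih (by omega)
      obtain ⟨k, hk⟩ : ∃ k, len S x / L - j = k + 1 := ⟨len S x / L - (j + 1), by omega⟩
      have hk' : len S x / L - (j + 1) = k := by omega
      rw [hk'] at ⊢
      rw [hk, gUp_succ c k, gUp_succ c k] at ih
      have hle : L * (k + 1) ≤ len S x :=
        (Nat.mul_le_mul_left L (by omega)).trans (Nat.mul_div_le (len S x) L)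
      rw [mul_add, mul_one] at hle
      have h1 := (hspec k (g := x) (by omega)).2
      have h2 := (hspec k (g := y) (by omega)).2
      have hx := hspec 1 (g := gUp c k x) (by omega)
      have hy := hspec 1 (g := gUp c k y) (by omega)
      have ht := congrArg Prod.snd (hall k (by omega) (by omega))
      simp only [aType, descNum] at ht
      rw [if_pos (by omega), if_pos (by omega), ← ih] at ht
      rw [← ih] at hy
      have mx := translator_mul_mem hgen hδ hinv hyp hN c (a := gUp c 1 (gUp c k x))
        (x := gUp c k x) ⟨hx.1, by omega⟩
      have my := translator_mul_mem hgen hδ hinv hyp hN c (a := gUp c 1 (gUp c k x))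
        (x := gUp c k y) ⟨hy.1, by omega⟩
      exact mul_left_cancel ((c.num_bijOn _).injOn mx my ht)
  have := key _ le_rfl
  rw [Nat.sub_self] at this
  exact hne (by simpa [gUp, pUp] using this)

end Descendants

/-! ### Decreasing lists -/

section Lists

theorem pairwise_decreasingList (K : Set ℕ) : (decreasingList K).Pairwise (· > ·) := by
  rw [decreasingList]
  split_ifs with h
  · have h1 := Finset.pairwise_sort h.toFinset (fun a b : ℕ => b ≤ a)
    have h2 := Finset.sort_nodup h.toFinset (fun a b : ℕ => b ≤ a)
    exact (h1.and h2).imp fun hab => lt_of_le_of_ne hab.1 hab.2.symm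
  · exact List.Pairwise.nil

theorem mem_decreasingList {K : Set ℕ} (hK : K.Finite) {k : ℕ} :
    k ∈ decreasingList K ↔ k ∈ K := by
  rw [decreasingList, dif_pos hK, Finset.mem_sort, Set.Finite.mem_toFinset]

/-- Compares the positions of a common element of two decreasing lists of equal length. -/
theorem exists_getElem_trichotomy {l₁ l₂ : List ℕ} (h₁ : l₁.Pairwise (· > ·))
    (h₂ : l₂.Pairwise (· > ·)) (hl : l₁.length = l₂.length) {k : ℕ} (hk₁ : k ∈ l₁)
    (hk₂ : k ∈ l₂) :
    ∃ (i : ℕ) (hi : i < l₁.length) (hi' : i < l₂.length),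
      (l₁[i] = k ∧ l₂[i] = k) ∨ (l₁[i] < k ∧ l₂[i] = k) ∨ (l₁[i] = k ∧ l₂[i] < k) := by
  obtain ⟨i, hi, rfl⟩ := List.getElem_of_mem hk₁
  obtain ⟨j, hj, hij⟩ := List.getElem_of_mem hk₂
  rcases lt_trichotomy i j with h | rfl | h
  -- The later of the two positions works: the list that reached `k` earlier has already dropped
  -- below it.
  · exact ⟨j, hl ▸ hj, hj, Or.inr (Or.inl ⟨List.pairwise_iff_getElem.1 h₁ i j hi _ h, hij⟩)⟩
  · exact ⟨i, hi, hj, Or.inl ⟨rfl, hij⟩⟩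
  · refine ⟨i, hi, hl ▸ hi, Or.inr (Or.inr ⟨rfl, ?_⟩)⟩
    have := List.pairwise_iff_getElem.1 h₂ j i hj (hl ▸ hi) h
    omega

theorem getElem_map_eq {α : Type*} {l₁ l₂ : List ℕ} {f₁ f₂ : ℕ → α}
    (h : l₁.map f₁ = l₂.map f₂) {i : ℕ} (hi : i < l₁.length) (hi' : i < l₂.length) :
    f₁ l₁[i] = f₂ l₂[i] := by
  have := List.getElem_of_eq h (i := i) (by simpa using hi)
  simpa using this

end Lists

/-! ### Cousins, `B`-types and torsion translations -/

section Cousins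

variable {G : Type*} [Group G] {S : Finset G} {N δ : ℝ} {L : ℕ}

/-- `Tor` is finite and its elements have finitely many powers, so the supremum is over a bounded
set and is not the default value. -/
theorem len_zpow_le_cousinRadius (hgen : Subgroup.closure (S : Set G) = ⊤)
    (hinv : ∀ x ∈ S, x⁻¹ ∈ S) {γ : G} (hγ : γ ∈ Tor S δ) (n : ℤ) :
    (len S (γ ^ n) : ℝ) ≤ cousinRadius S δ := by
  refine le_csSup (Set.Finite.bddAbove (Set.Finite.union ?_ (Set.finite_singleton _)))
    (Or.inl ⟨γ, hγ, n, rfl⟩)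
  have hfin : (Tor S δ).Finite :=
    (finite_setOf_len_le_real hgen hinv (16 * δ)).subset fun _ hx => hx.1
  refine (hfin.biUnion (t := fun x => (fun y => (len S y : ℝ)) '' (Subgroup.zpowers x : Set G))
    fun x hx => (finite_zpowers.2 hx.2).image _).subset ?_
  rintro r ⟨x, hx, n, rfl⟩
  exact Set.mem_biUnion hx ⟨x ^ n, ⟨n, rfl⟩, rfl⟩

theorem finite_cousins (hgen : Subgroup.closure (S : Set G) = ⊤) (hinv : ∀ x ∈ S, x⁻¹ ∈ S)
    (g : G) : (cousins S δ g).Finite := by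
  refine ((finite_setOf_len_le_real hgen hinv (cousinRadius S δ)).image (fun x => g * x)).subset ?_
  intro x hx
  refine ⟨g⁻¹ * x, ?_, mul_inv_cancel_left _ _⟩
  have := hx.2
  rwa [dist_eq_len hgen] at this

theorem mem_kSeq (hgen : Subgroup.closure (S : Set G) = ⊤) (hinv : ∀ x ∈ S, x⁻¹ ∈ S)
    (c : Choices S N L) {g : G} {k : ℕ} :
    k ∈ kSeq c δ g ↔ (∃ g' ∈ cousins S δ g, ∃ g'' ∈ cousins S δ g,
      g' ≠ g'' ∧ k = diffGen c g' g'') ∨ k = 0 := by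
  have hfin : (cousins S δ g).Finite := finite_cousins hgen hinv g
  refine mem_decreasingList (Set.Finite.union ?_ (Set.finite_singleton 0))
  refine (hfin.image2 (diffGen c) hfin).subset ?_
  rintro k ⟨x, hx, y, hy, -, rfl⟩
  exact ⟨x, hx, y, hy, rfl⟩

theorem cousins_of_bType_eq {c : Choices S N L} {g h : G} (hB : bType c δ g = bType c δ h) {x : G}
    (hx : g * x ∈ cousins S δ g) :
    h * x ∈ cousins S δ h ∧ wSeq c δ g (g * x) = wSeq c δ h (h * x) := by
  have hmem : (g⁻¹ * (g * x), wSeq c δ g (g * x)) ∈ bType c δ g := ⟨_, hx, rfl⟩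
  rw [hB] at hmem
  obtain ⟨y, hy, he⟩ := hmem
  rw [Prod.mk.injEq, inv_mul_cancel_left] at he
  obtain ⟨rfl, hw⟩ := he
  rw [mul_inv_cancel_left]
  exact ⟨hy, hw⟩

theorem self_mem_cousins (hδ : 0 ≤ δ) (hgen : Subgroup.closure (S : Set G) = ⊤)
    (hinv : ∀ x ∈ S, x⁻¹ ∈ S) (g : G) : g ∈ cousins S δ g := by
  refine ⟨rfl, ?_⟩
  have h1 : (1 : G) ∈ Tor S δ := ⟨by rw [len_one]; simpa using hδ, IsOfFinOrder.one⟩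
  have := len_zpow_le_cousinRadius hgen hinv h1 0
  rw [zpow_zero, len_one] at this
  rwa [dist_self]

/-- Elements of the same `B`-type have the same `A`-type. -/
theorem aType_eq_of_bType_eq (hδ : 0 ≤ δ) (hgen : Subgroup.closure (S : Set G) = ⊤)
    (hinv : ∀ x ∈ S, x⁻¹ ∈ S) {c : Choices S N L} {g h : G} (hB : bType c δ g = bType c δ h) :
    aType c g = aType c h := by
  have hw := (cousins_of_bType_eq hB (x := 1)
    (by rw [mul_one]; exact self_mem_cousins hδ hgen hinv g)).2
  rw [mul_one, mul_one, wSeq, wSeq] at hw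
  have hl := congrArg List.length hw
  rw [List.length_map, List.length_map] at hl
  obtain ⟨i, hi, hi', hcase⟩ := exists_getElem_trichotomy (pairwise_decreasingList _)
    (pairwise_decreasingList _) hl (k := 0) ((mem_kSeq hgen hinv c).2 (Or.inr rfl))
    ((mem_kSeq hgen hinv c).2 (Or.inr rfl))
  -- Nothing lies below `0`, so it has the same position in both lists.
  obtain ⟨h1, h2⟩ : (kSeq c δ g)[i] = 0 ∧ (kSeq c δ h)[i] = 0 := by
    rcases hcase with hc | hc | hc
    · exact hc
    · exact absurd hc.1 (Nat.not_lt_zero _)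
    · exact absurd hc.2 (Nat.not_lt_zero _)
  have := getElem_map_eq hw hi hi'
  rw [h1, h2] at this
  simpa [gUp, pUp] using this

/-- If `g` and `g * γ` have the same ball type and length, then the short powers of `γ` move `g`
along the sphere around `1`. -/
theorem len_mul_zpow_eq_of_ballType_eq {g γ : G} (hlen : len S g = len S (g * γ))
    (hb : ballType S N g = ballType S N (g * γ)) {n : ℕ}
    (hn : ∀ i : ℤ, i.natAbs ≤ n → (len S (γ ^ i) : ℝ) ≤ N) (i : ℤ) (hi : i.natAbs ≤ n) :
    len S (g * γ ^ i) = len S g := by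
  have step : ∀ i : ℤ, i.natAbs ≤ n → len S (g * γ ^ i) = len S (g * γ ^ (i + 1)) := by
    intro i hi
    have := len_mul_sub_of_ballType_eq hb (hn i hi)
    rw [mul_assoc, ← zpow_one_add, add_comm 1 i] at this
    omega
  induction i with
  | zero => rw [zpow_zero, mul_one]
  | succ i ih => rw [← step i (by omega)]; exact ih (by omega)
  | pred i ih =>
    rw [step _ hi, sub_add_cancel]
    exact ih (by omega)

/-- Elements of the same `B`-type that differ by a torsion element coincide. -/
theorem eq_of_bType_eq_of_mem_Tor (hgen : Subgroup.closure (S : Set G) = ⊤) (hδ : 0 ≤ δ)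
    (hinv : ∀ x ∈ S, x⁻¹ ∈ S) (hyp : IsHyperbolicWith S δ) (hN : 2 * δ + 2 ≤ N) (hL : 1 ≤ L)
    (c : Choices S N L) {g γ : G} (hlen : len S g = len S (g * γ)) (hγ : γ ∈ Tor S δ)
    (hB : bType c δ g = bType c δ (g * γ)) : γ = 1 := by
  by_contra hne
  have hR := len_zpow_le_cousinRadius hgen hinv hγ
  have hmul : ∀ n : ℤ, g * γ * γ ^ n = g * γ ^ (n + 1) := fun n => by
    rw [mul_assoc, ← zpow_one_add, add_comm 1 n]
  have hcg : ∀ n : ℤ, len S (g * γ ^ n) = len S g → g * γ ^ n ∈ cousins S δ g := by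
    intro n hn
    refine ⟨hn.symm, ?_⟩
    rw [dist_mul_right_self hgen]
    exact hR n
  have hch : ∀ n : ℤ, len S (g * γ ^ n) = len S g → g * γ ^ n ∈ cousins S δ (g * γ) := by
    intro n hn
    refine ⟨(hn.trans hlen).symm, ?_⟩
    rw [← sub_add_cancel n 1, ← hmul, dist_mul_right_self hgen]
    exact hR _
  -- Equal `B`-types carry cousins of `g` to cousins of `g * γ` by the left translation taking `g`
  -- to `g * γ`; this shifts the exponent by one, and the converse shifts it back.
  have hsphere : ∀ n : ℤ, len S (g * γ ^ n) = len S g := by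
    intro n
    induction n with
    | zero => rw [zpow_zero, mul_one]
    | succ n ih =>
      have := (cousins_of_bType_eq hB (hcg _ ih)).1.1
      rw [hmul] at this
      omega
    | pred n ih =>
      have h1 := hch _ ih
      rw [← sub_add_cancel (-(n : ℤ)) 1, ← hmul] at h1
      exact (cousins_of_bType_eq hB.symm h1).1.1.symm
  have hw : ∀ n : ℤ, wSeq c δ g (g * γ ^ n) = wSeq c δ (g * γ) (g * γ ^ (n + 1)) := by
    intro n
    rw [← hmul]
    exact (cousins_of_bType_eq hB (hcg n (hsphere n))).2
  simp only [wSeq] at hw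
  have hl := congrArg List.length (hw 0)
  rw [List.length_map, List.length_map] at hl
  have hdiff : ∀ a b : ℤ, g * γ ^ a ≠ g * γ ^ b → diffGen c (g * γ ^ a) (g * γ ^ b) ∈
      {k | L * k ≤ len S (g * γ ^ a) ∧ L * k ≤ len S (g * γ ^ b) ∧
        aType c (gUp c k (g * γ ^ a)) ≠ aType c (gUp c k (g * γ ^ b))} := fun a b hab =>
    Nat.sInf_mem (exists_aType_gUp_ne hgen hδ hinv hyp hN hL c
      ((hsphere a).trans (hsphere b).symm) hab)
  -- `k` is the least generation separating two orbit points. It belongs to both `k`-sequences,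
  -- since the orbit consists of common cousins.
  obtain ⟨k, ⟨a, b, hab, rfl⟩, hmin⟩ := wellFounded_lt.has_min
    {k | ∃ a b : ℤ, g * γ ^ a ≠ g * γ ^ b ∧ k = diffGen c (g * γ ^ a) (g * γ ^ b)}
    ⟨_, 1, 0, by simpa using hne, rfl⟩
  have hk := hdiff a b hab
  have hmem : ∀ g₀ : G, (∀ n : ℤ, g * γ ^ n ∈ cousins S δ g₀) →
      diffGen c (g * γ ^ a) (g * γ ^ b) ∈ kSeq c δ g₀ := fun g₀ h₀ =>
    (mem_kSeq hgen hinv c).2 (Or.inl ⟨_, h₀ a, _, h₀ b, hab, rfl⟩)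
  have hmem₁ := hmem g fun n => hcg n (hsphere n)
  have hmem₂ := hmem (g * γ) fun n => hch n (hsphere n)
  generalize diffGen c (g * γ ^ a) (g * γ ^ b) = k at hk hmin hmem₁ hmem₂
  obtain ⟨hk1, -, hk3⟩ := hk
  rw [hsphere] at hk1
  have hlow : ∀ k' < k, ∀ a b : ℤ,
      aType c (gUp c k' (g * γ ^ a)) = aType c (gUp c k' (g * γ ^ b)) := by
    intro k' hk' a b
    by_contra hc
    have hab' : g * γ ^ a ≠ g * γ ^ b := fun h => hc (by rw [h])
    have hle : L * k' ≤ len S g := (Nat.mul_le_mul_left L hk'.le).trans hk1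
    exact hmin _ ⟨a, b, hab', rfl⟩ (lt_of_le_of_lt
      (Nat.sInf_le ⟨by rwa [hsphere], by rwa [hsphere], hc⟩) hk')
  -- The two `k`-sequences are only known to have equal length, so `k` may face some `k' < k` in the
  -- other. There the `A`-type is constant on the orbit by minimality, and `hw` transfers this to
  -- generation `k`.
  have hstep : ∀ n : ℤ,
      aType c (gUp c k (g * γ ^ n)) = aType c (gUp c k (g * γ ^ (n + 1))) := by
    obtain ⟨i, hi, hi', hcase⟩ := exists_getElem_trichotomy (pairwise_decreasingList _)
      (pairwise_decreasingList _) hl hmem₁ hmem₂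
    have hget := fun n => getElem_map_eq (hw n) hi hi'
    change ((kSeq c δ g)[i] = k ∧ (kSeq c δ (g * γ))[i] = k) ∨
      ((kSeq c δ g)[i] < k ∧ (kSeq c δ (g * γ))[i] = k) ∨
      ((kSeq c δ g)[i] = k ∧ (kSeq c δ (g * γ))[i] < k) at hcase
    rcases hcase with ⟨h1, h2⟩ | ⟨h1, h2⟩ | ⟨h1, h2⟩
    · intro n
      have := hget n
      rwa [h1, h2] at this
    · intro n
      have e1 := hget (n - 1)
      have e2 := hget n
      rw [h2, sub_add_cancel] at e1
      rw [h2] at e2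
      rw [← e1, ← e2]
      exact hlow _ h1 _ _
    · intro n
      have e1 := hget n
      have e2 := hget (n + 1)
      rw [h1] at e1 e2
      rw [e1, e2]
      exact hlow _ h2 _ _
  have hconst : ∀ n : ℤ, aType c (gUp c k (g * γ ^ n)) = aType c (gUp c k (g * γ ^ (0 : ℤ))) := by
    intro n
    induction n with
    | zero => rfl
    | succ n ih => rw [← hstep]; exact ih
    | pred n ih => rw [hstep, sub_add_cancel]; exact ih
  exact hk3 ((hconst a).trans (hconst b).symm)

end Cousins

end HypGroup

/-! ### The proposition -/

theorem mainTheorem7 {G : Type*} [Group G] (S : Finset G)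
    (hgen : Subgroup.closure (S : Set G) = ⊤) (hinv : ∀ x ∈ S, x⁻¹ ∈ S)
    (δ : ℝ) (hδ : 1 ≤ δ) (hyp : HypGroup.IsHyperbolicWith S δ) :
    ∃ N₁ : ℝ, ∀ N : ℝ, N₁ ≤ N → ∀ L : ℕ, 1 ≤ L → ∀ c : HypGroup.Choices S N L,
      ∀ g h : G, HypGroup.len S g = HypGroup.len S h →
        (HypGroup.dist S g h : ℝ) ≤ 16 * δ →
        HypGroup.bType c δ g = HypGroup.bType c δ h → g = h := by
  have hδ0 : 0 ≤ δ := by linarith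
  let n : ℕ := 2 * {x : G | (HypGroup.len S x : ℝ) ≤ 8 * δ + 1}.ncard
  -- `2δ + 2` is what the cone argument needs; `16δn` bounds the lengths of `γ ^ i` for `|i| ≤ n`.
  refine ⟨max (2 * δ + 2) (n * (16 * δ)), fun N hN L hL c g h hlen hdist hB => ?_⟩
  have hN1 : 2 * δ + 2 ≤ N := (le_max_left _ _).trans hN
  have hN2 : n * (16 * δ) ≤ N := (le_max_right _ _).trans hN
  obtain ⟨γ, rfl⟩ : ∃ γ, h = g * γ := ⟨g⁻¹ * h, by rw [mul_inv_cancel_left]⟩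
  rw [HypGroup.dist_mul_right_self hgen] at hdist
  have hz := congrArg Prod.fst (HypGroup.aType_eq_of_bType_eq hδ0 hgen hinv hB)
  simp only [HypGroup.aType, HypGroup.zType, ← hlen] at hz
  split_ifs at hz with hLg
  · have hγ : IsOfFinOrder γ := by
      refine HypGroup.isOfFinOrder_of_len_mul_zpow_eq hgen hinv hyp (Nat.lt_succ_self n)
        (HypGroup.len_mul_zpow_eq_of_ballType_eq hlen (Sum.inl_injective hz) fun i hi => ?_)
      refine le_trans ?_ hN2
      have h1 : (HypGroup.len S (γ ^ i) : ℝ) ≤ i.natAbs * HypGroup.len S γ :=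
        mod_cast HypGroup.len_zpow_le hgen γ i
      have h2 : (i.natAbs : ℝ) ≤ n := mod_cast hi
      exact h1.trans (mul_le_mul h2 hdist (Nat.cast_nonneg _) (Nat.cast_nonneg _))
    rw [HypGroup.eq_of_bType_eq_of_mem_Tor hgen hδ0 hinv hyp hN1 hL c hlen ⟨hdist, hγ⟩ hB, mul_one]
  · exact Sum.inr_injective hz
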